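/- **Setting.** Let $A\subset C$ and $B\subset D$ be unital inclusions of unital $C^*$-algebras (closed $*$-subalgebras containing the unit) which are strongly Morita equivalent with respect to a $C$-$D$-equivalence bimodule $Y$ and its closed subspace $X$. That is, $Y$ is a full left Hilbert $C$-module with inner product ${}_C\langle\cdot,\cdot\rangle$ (linear in the first variable) and a full right Hilbert $D$-module with inner product $\langle\cdot,\cdot\rangle_D$ (linear in the second variable), both inducing the same complete norm, the two actions commute, and $${}_C\langle x\cdot d,y\rangle={}_C\langle x,y\cdot d^*\rangle,\qquad \langle c\cdot x,y\rangle_D=\langle x,c^*\cdot y\rangle_D,\qquad {}_C\langle x,y\rangle\cdot z=x\cdot\langle y,z\rangle_D$$ for all $x,y,z\in Y$, $c\in C$, $d\in D$; and $X\subset Y$ is a closed linear subspace such that 1. $a\cdot x\in X$ and ${}_C\langle x,y\rangle\in A$ for all $a\in A$, $x,y\in X$, and the closed linear spans of ${}_C\langle X,X\rangle$ and ${}_C\langle Y,X\rangle$ are $A$ and $C$, respectively; 2. $x\cdot b\in X$ and $\langle x,y\rangle_D\in B$ for all $b\in B$, $x,y\in X$, and the closed linear spans of $\langle X,X\rangle_D$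 and $\langle Y,X\rangle_D$ are $B$ and $D$, respectively. Let ${}_A\mathbf B_A(C,A)$ (resp. ${}_B\mathbf B_B(D,B)$) be the space of bounded linear $A$-bimodule maps $C\to A$ (resp. $B$-bimodule maps $D\to B$). For each $\phi\in{}_A\mathbf B_A(C,A)$ there are a unique linear map $\tau:Y\to X$ and a unique $\psi\in{}_B\mathbf B_B(D,B)$ such that, for all $a\in A$, $b\in B$, $c\in C$, $d\in D$, $x\in X$, $y\in Y$, $$\tau(c\cdot x)=\phi(c)\cdot x,\quad \tau(a\cdot y)=a\cdot\tau(y),\quad {}_C\langle\tau(y),x\rangle=\phi({}_C\langle y,x\rangle),$$ $$\tau(x\cdot d)=x\cdot\psi(d),\quad \tau(y\cdot b)=\tau(y)\cdot b,\quad \psi(\langle x,y\rangle_D)=\langle x,\tau(y)\rangle_D .$$ Put $f(\phi)=\psi$. An element $\phi\in{}_A\mathbf B_A(C,A)$ is a *conditional expectation* from $C$ onto $A$ if it is positive and $\phi(a)=a$ for all $a\in A$. It is of *Watatani index-finite type* if it has a quasi-basis, i.e. there are finitely many pairs $(u_i,v_i)\in C\times C$, $1\le i\le m$, with $$c=\sum_{i=1}^m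 u_i\,\phi(v_i c)=\sum_{i=1}^m \phi(c u_i)\,v_i\qquad\text{for all } c\in C.$$ The same terms are used for $B\subset D$. **Corollary.** If $E^A$ is a conditional expectation from $C$ onto $A$ of Watatani index-finite type, then $f(E^A)$ is a conditional expectation from $D$ onto $B$ of Watatani index-finite type. -/

import Mathlib

namespace InclusionMorita

open MulOpposite

/-- A `C`-`D`-equivalence bimodule `Y` (also called an imprimitivity bimodule): a Banach space with
commuting left `C`-action and right `D`-action (written as a left action of `Dᵐᵒᵖ`, so that
`y · d` is `op d • y`), which is a full left Hilbert `C`-module for `leftInner` and a full right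
Hilbert `D`-module for `rightInner`, such that each algebra acts by adjointable operators for the
other inner product and `⟨x, y⟩_C · z = x · ⟨y, z⟩_D`.
The left inner product is linear in its first variable, the right one in its second. -/
structure EquivalenceBimodule (C D Y : Type*)
    [CStarAlgebra C] [PartialOrder C] [StarOrderedRing C]
    [CStarAlgebra D] [PartialOrder D] [StarOrderedRing D]
    [NormedAddCommGroup Y] [NormedSpace ℂ Y] [CompleteSpace Y]
    [Module C Y] [Module Dᵐᵒᵖ Y] where
  /-- the `C`-valued inner product -/
  leftInner : Y → Y → C
  /-- the `D`-valued inner product -/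
  rightInner : Y → Y → D
  smul_assoc_left (t : ℂ) (c : C) (y : Y) : (t • c) • y = t • (c • y)
  smul_assoc_right (t : ℂ) (d : D) (y : Y) : op (t • d) • y = t • (op d • y)
  smul_comm (c : C) (d : D) (y : Y) : c • (op d • y) = op d • (c • y)
  leftInner_add_left (x y z : Y) : leftInner (x + y) z = leftInner x z + leftInner y z
  leftInner_smul_left (c : C) (x y : Y) : leftInner (c • x) y = c * leftInner x y
  star_leftInner (x y : Y) : star (leftInner x y) = leftInner y x
  leftInner_self_nonneg (x : Y) : 0 ≤ leftInner x x
  leftInner_self_eq_zero (x : Y) : leftInner x x = 0 → x = 0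
  norm_sq_eq_leftInner (x : Y) : ‖x‖ ^ 2 = ‖leftInner x x‖
  rightInner_add_right (x y z : Y) : rightInner x (y + z) = rightInner x y + rightInner x z
  rightInner_smul_right (d : D) (x y : Y) : rightInner x (op d • y) = rightInner x y * d
  star_rightInner (x y : Y) : star (rightInner x y) = rightInner y x
  rightInner_self_nonneg (x : Y) : 0 ≤ rightInner x x
  rightInner_self_eq_zero (x : Y) : rightInner x x = 0 → x = 0
  norm_sq_eq_rightInner (x : Y) : ‖x‖ ^ 2 = ‖rightInner x x‖
  leftInner_op_smul (d : D) (x y : Y) : leftInner (op d • x) y = leftInner x (op (star d) • y)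
  rightInner_smul (c : C) (x y : Y) : rightInner (c • x) y = rightInner x (star c • y)
  leftInner_smul (x y z : Y) : leftInner x y • z = op (rightInner y z) • x
  left_full : closure (Submodule.span ℂ {c : C | ∃ x y, leftInner x y = c} : Set C) = Set.univ
  right_full : closure (Submodule.span ℂ {d : D | ∃ x y, rightInner x y = d} : Set D) = Set.univ

variable {C D Y : Type*}
  [CStarAlgebra C] [PartialOrder C] [StarOrderedRing C]
  [CStarAlgebra D] [PartialOrder D] [StarOrderedRing D]
  [NormedAddCommGroup Y] [NormedSpace ℂ Y] [CompleteSpace Y]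
  [Module C Y] [Module Dᵐᵒᵖ Y]

/-- The unital inclusions of unital C⋆-algebras `A ⊆ C` and `B ⊆ D` are strongly Morita equivalent
with respect to the `C`-`D`-equivalence bimodule `Y` (with structure `E`) and its closed
subspace `X`. -/
structure IsMoritaPair (A : StarSubalgebra ℂ C) (B : StarSubalgebra ℂ D)
    (E : EquivalenceBimodule C D Y) (X : Submodule ℂ Y) : Prop where
  isClosed_left : IsClosed (A : Set C)
  isClosed_right : IsClosed (B : Set D)
  isClosed_subspace : IsClosed (X : Set Y)
  smul_mem (a : C) (x : Y) : a ∈ A → x ∈ X → a • x ∈ X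
  leftInner_mem (x y : Y) : x ∈ X → y ∈ X → E.leftInner x y ∈ A
  closure_left : closure (Submodule.span ℂ
    {c : C | ∃ x ∈ X, ∃ y ∈ X, E.leftInner x y = c} : Set C) = A
  closure_left_top : closure (Submodule.span ℂ
    {c : C | ∃ y : Y, ∃ x ∈ X, E.leftInner y x = c} : Set C) = Set.univ
  op_smul_mem (b : D) (x : Y) : b ∈ B → x ∈ X → op b • x ∈ X
  rightInner_mem (x y : Y) : x ∈ X → y ∈ X → E.rightInner x y ∈ B
  closure_right : closure (Submodule.span ℂ
    {d : D | ∃ x ∈ X, ∃ y ∈ X, E.rightInner x y = d} : Set D) = B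
  closure_right_top : closure (Submodule.span ℂ
    {d : D | ∃ y : Y, ∃ x ∈ X, E.rightInner y x = d} : Set D) = Set.univ

/-- The space of bounded `A`-bimodule linear maps from `C` to `A`. -/
def BimoduleMaps {C : Type*} [CStarAlgebra C] (A : StarSubalgebra ℂ C) :
    Submodule ℂ (C →L[ℂ] A) where
  carrier := {φ | ∀ (a : A) (c : C), φ (a * c) = a * φ c ∧ φ (c * a) = φ c * a}
  add_mem' := by
    intro φ ψ hφ hψ a c
    simp [(hφ a c).1, (hφ a c).2, (hψ a c).1, (hψ a c).2, mul_add, add_mul]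
  zero_mem' := by intro a c; simp
  smul_mem' := by
    intro t φ hφ a c
    simp [(hφ a c).1, (hφ a c).2]

/-- A bounded `A`-bimodule map `φ : C → A` is a conditional expectation from `C` onto `A` if it is
positive and restricts to the identity on `A`. -/
def IsConditionalExpectation {C : Type*} [CStarAlgebra C] [PartialOrder C]
    {A : StarSubalgebra ℂ C} (φ : BimoduleMaps A) : Prop :=
  (∀ a : A, φ.1 (a : C) = a) ∧ ∀ c : C, 0 ≤ c → 0 ≤ (φ.1 c : C)

/-- The finite family `(u i, v i)` is a quasi-basis for `φ`. -/
def IsQuasiBasis {C : Type*} [CStarAlgebra C] {A : StarSubalgebra ℂ C} (φ : BimoduleMaps A)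
    {m : ℕ} (u v : Fin m → C) : Prop :=
  ∀ c : C, c = ∑ i, u i * (φ.1 (v i * c) : C) ∧ c = ∑ i, (φ.1 (c * u i) : C) * v i

/-- Watatani index-finite type: there is a quasi-basis. -/
def IsIndexFinite {C : Type*} [CStarAlgebra C] {A : StarSubalgebra ℂ C}
    (φ : BimoduleMaps A) : Prop :=
  ∃ (m : ℕ) (u v : Fin m → C), IsQuasiBasis φ u v

/-- The conditions tying a bimodule map `φ : C → A` to a linear map `τ : Y → X` and a bimodule map
`ψ : D → B`. -/
structure IsTransfer {A : StarSubalgebra ℂ C} {B : StarSubalgebra ℂ D}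
    (E : EquivalenceBimodule C D Y) {X : Submodule ℂ Y}
    (φ : BimoduleMaps A) (τ : Y →ₗ[ℂ] X) (ψ : BimoduleMaps B) : Prop where
  tau_smul (c : C) (x : X) : (τ (c • (x : Y)) : Y) = (φ.1 c : C) • (x : Y)
  tau_smul_left (a : A) (y : Y) : (τ ((a : C) • y) : Y) = (a : C) • (τ y : Y)
  leftInner_tau (y : Y) (x : X) : E.leftInner (τ y) x = φ.1 (E.leftInner y x)
  tau_op_smul (d : D) (x : X) : (τ (op d • (x : Y)) : Y) = op (ψ.1 d : D) • (x : Y)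
  tau_op_smul_right (b : B) (y : Y) : (τ (op (b : D) • y) : Y) = op (b : D) • (τ y : Y)
  psi_rightInner (x : X) (y : Y) : (ψ.1 (E.rightInner x y) : D) = E.rightInner x (τ y)

namespace EquivalenceBimodule

variable (E : EquivalenceBimodule C D Y)

theorem leftInner_smul_complex (t : ℂ) (x y : Y) :
    E.leftInner (t • x) y = t • E.leftInner x y := by
  have : t • x = (t • (1 : C)) • x := by rw [E.smul_assoc_left, one_smul]
  rw [this, E.leftInner_smul_left, smul_mul_assoc, one_mul]

theorem rightInner_smul_complex (t : ℂ) (x y : Y) :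
    E.rightInner x (t • y) = t • E.rightInner x y := by
  have : t • y = op (t • (1 : D)) • y := by rw [E.smul_assoc_right, op_one, one_smul]
  rw [this, E.rightInner_smul_right, mul_smul_comm, mul_one]

/-- The left inner product as a linear map in its first variable. -/
def leftInnerₗ (y : Y) : Y →ₗ[ℂ] C where
  toFun x := E.leftInner x y
  map_add' x z := E.leftInner_add_left x z y
  map_smul' t x := E.leftInner_smul_complex t x y

/-- The right inner product as a linear map in its second variable. -/
def rightInnerₗ (x : Y) : Y →ₗ[ℂ] D where
  toFun y := E.rightInner x y
  map_add' y z := E.rightInner_add_right x y z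
  map_smul' t y := E.rightInner_smul_complex t x y

theorem leftInner_sum {ι : Type*} (s : Finset ι) (x : ι → Y) (y : Y) :
    E.leftInner (∑ i ∈ s, x i) y = ∑ i ∈ s, E.leftInner (x i) y :=
  map_sum (E.leftInnerₗ y) x s

theorem leftInner_add_right (x y z : Y) :
    E.leftInner x (y + z) = E.leftInner x y + E.leftInner x z := by
  rw [← E.star_leftInner, E.leftInner_add_left, star_add, E.star_leftInner, E.star_leftInner]

theorem rightInner_add_left (x y z : Y) :
    E.rightInner (x + y) z = E.rightInner x z + E.rightInner y z := by
  rw [← E.star_rightInner, E.rightInner_add_right, star_add, E.star_rightInner,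
    E.star_rightInner]

theorem leftInner_smul_complex_right (t : ℂ) (x y : Y) :
    E.leftInner x (t • y) = star t • E.leftInner x y := by
  rw [← E.star_leftInner, E.leftInner_smul_complex, star_smul, E.star_leftInner]

theorem rightInner_smul_complex_left (t : ℂ) (x y : Y) :
    E.rightInner (t • x) y = star t • E.rightInner x y := by
  rw [← E.star_rightInner, E.rightInner_smul_complex, star_smul, E.star_rightInner]

theorem norm_le_of_polarization {V W : Type*} [NormedAddCommGroup V] [NormedSpace ℂ V]
    [NormedAddCommGroup W] [NormedSpace ℂ W] (g : V → W) (hg : ∀ v, ‖g v‖ = ‖v‖ ^ 2)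
    (x y : V) (w : W)
    (h : (4 : ℂ) • w = g (x + y) - g (x - y) + Complex.I • g (x + Complex.I • y)
      - Complex.I • g (x - Complex.I • y)) : ‖w‖ ≤ (‖x‖ + ‖y‖) ^ 2 := by
  have hI : ‖Complex.I • y‖ = ‖y‖ := by rw [norm_smul, Complex.norm_I, one_mul]
  have key : ∀ z : V, ‖z‖ ≤ ‖x‖ + ‖y‖ → ‖g z‖ ≤ (‖x‖ + ‖y‖) ^ 2 := by
    intro z hz
    rw [hg]
    gcongr
  have h1 := key (x + y) (norm_add_le _ _)
  have h2 := key (x - y) (norm_sub_le _ _)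
  have h3 := key (x + Complex.I • y) ((norm_add_le _ _).trans_eq (by rw [hI]))
  have h4 := key (x - Complex.I • y) ((norm_sub_le _ _).trans_eq (by rw [hI]))
  have h5 : ‖(4 : ℂ) • w‖ = 4 * ‖w‖ := by rw [norm_smul]; norm_num
  have h6 : ‖(4 : ℂ) • w‖ ≤ ‖g (x + y)‖ + ‖g (x - y)‖ + ‖g (x + Complex.I • y)‖
      + ‖g (x - Complex.I • y)‖ := by
    rw [h]
    refine (norm_sub_le _ _).trans ?_
    rw [norm_smul, Complex.norm_I, one_mul]
    gcongr
    refine (norm_add_le _ _).trans ?_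
    rw [norm_smul, Complex.norm_I, one_mul]
    gcongr
    exact norm_sub_le _ _
  linarith

theorem norm_leftInner_le (x y : Y) : ‖E.leftInner x y‖ ≤ (‖x‖ + ‖y‖) ^ 2 := by
  refine norm_le_of_polarization (fun v => E.leftInner v v)
    (fun v => (E.norm_sq_eq_leftInner v).symm) x y _ ?_
  simp only [sub_eq_add_neg, ← neg_one_smul ℂ (y), ← neg_one_smul ℂ (Complex.I • y),
    E.leftInner_add_left, E.leftInner_add_right,
    E.leftInner_smul_complex, E.leftInner_smul_complex_right]
  simp only [RCLike.star_def, Complex.conj_I, map_neg, map_one]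
  match_scalars <;> ring_nf <;> simp
  norm_num

theorem norm_rightInner_le (x y : Y) : ‖E.rightInner x y‖ ≤ (‖x‖ + ‖y‖) ^ 2 := by
  rw [← norm_star, E.star_rightInner]
  refine norm_le_of_polarization (fun v => E.rightInner v v)
    (fun v => (E.norm_sq_eq_rightInner v).symm) x y _ ?_
  simp only [sub_eq_add_neg, ← neg_one_smul ℂ (y), ← neg_one_smul ℂ (Complex.I • y),
    E.rightInner_add_right, E.rightInner_add_left,
    E.rightInner_smul_complex, E.rightInner_smul_complex_left]
  simp only [RCLike.star_def, Complex.conj_I, map_neg, map_one]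
  match_scalars <;> ring_nf <;> simp
  norm_num

theorem continuous_of_quadratic_bound {V W : Type*} [NormedAddCommGroup V] [NormedSpace ℂ V]
    [NormedAddCommGroup W] [NormedSpace ℂ W] (g : V →ₗ[ℂ] W) (K : ℝ)
    (h : ∀ v, ‖g v‖ ≤ (K + ‖v‖) ^ 2) : Continuous g := by
  obtain ⟨M, hM⟩ := LinearMap.bound_of_ball_bound (r := 1) one_pos ((|K| + 1) ^ 2) g (by
    intro v hv
    rw [mem_ball_zero_iff] at hv
    refine (h v).trans (sq_le_sq' ?_ ?_)
    · have := neg_abs_le K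
      have := norm_nonneg v
      linarith
    · have := le_abs_self K
      linarith)
  exact (g.mkContinuous M hM).continuous

theorem continuous_leftInner (y : Y) : Continuous (E.leftInnerₗ y) :=
  continuous_of_quadratic_bound _ ‖y‖ fun v => by
    rw [add_comm ‖y‖]
    exact E.norm_leftInner_le v y

theorem continuous_rightInner (x : Y) : Continuous (E.rightInnerₗ x) :=
  continuous_of_quadratic_bound _ ‖x‖ fun v => E.norm_rightInner_le x v

/-- The left action on a fixed vector. -/
noncomputable def smulₗ (y : Y) : C →L[ℂ] Y :=
  LinearMap.mkContinuous
    { toFun := fun c => c • y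
      map_add' := fun c c' => add_smul c c' y
      map_smul' := fun t c => E.smul_assoc_left t c y } ‖y‖ fun c => by
    refine le_of_sq_le_sq (a := ‖c • y‖) ?_ (by positivity)
    rw [E.norm_sq_eq_leftInner, E.leftInner_smul_left, ← E.star_leftInner, E.leftInner_smul_left,
      mul_pow, E.norm_sq_eq_leftInner y]
    calc ‖c * star (c * E.leftInner y y)‖ ≤ ‖c‖ * ‖star (c * E.leftInner y y)‖ := norm_mul_le _ _
      _ ≤ ‖c‖ * (‖c‖ * ‖E.leftInner y y‖) := by
        rw [norm_star]
        gcongr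
        exact norm_mul_le _ _
      _ = ‖E.leftInner y y‖ * ‖c‖ ^ 2 := by ring

/-- The right action on a fixed vector. -/
noncomputable def opSmulₗ (y : Y) : D →L[ℂ] Y :=
  LinearMap.mkContinuous
    { toFun := fun d => op d • y
      map_add' := fun d d' => add_smul (op d) (op d') y
      map_smul' := fun t d => E.smul_assoc_right t d y } ‖y‖ fun d => by
    refine le_of_sq_le_sq (a := ‖op d • y‖) ?_ (by positivity)
    rw [E.norm_sq_eq_rightInner, E.rightInner_smul_right, ← E.star_rightInner,
      E.rightInner_smul_right, mul_pow, E.norm_sq_eq_rightInner y]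
    calc ‖star (E.rightInner y y * d) * d‖ ≤ ‖star (E.rightInner y y * d)‖ * ‖d‖ :=
          norm_mul_le _ _
      _ ≤ (‖E.rightInner y y‖ * ‖d‖) * ‖d‖ := by
        rw [norm_star]
        gcongr
        exact norm_mul_le _ _
      _ = ‖E.rightInner y y‖ * ‖d‖ ^ 2 := by ring

end EquivalenceBimodule

section Transfer

variable {A : StarSubalgebra ℂ C} {B : StarSubalgebra ℂ D}
  {E : EquivalenceBimodule C D Y} {X : Submodule ℂ Y}

theorem IsMoritaPair.exists_frame (h : IsMoritaPair A B E X) :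
    ∃ (n : ℕ) (x z : Fin n → X), ∑ i, E.rightInner (x i) (z i) = 1 := by
  have h1 : (1 : D) ∈ closure (Submodule.span ℂ
    {d : D | ∃ x ∈ X, ∃ y ∈ X, E.rightInner x y = d} : Set D) := by
    rw [h.closure_right]
    exact B.one_mem
  obtain ⟨s, hs, hs1⟩ := Metric.mem_closure_iff.1 h1 1 one_pos
  have hsB : s ∈ B := by
    have := subset_closure hs
    rwa [h.closure_right] at this
  have hu : IsUnit s := by
    have := (Units.oneSub (1 - s) (by rwa [dist_eq_norm] at hs1)).isUnit
    simpa using this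
  have : IsClosed (B : Set D) := h.isClosed_right
  obtain ⟨b, hb⟩ : ∃ b : B, s * b = 1 := by
    have hu' : IsUnit (⟨s, hsB⟩ : B) := (StarSubalgebra.coe_isUnit (S := B)).1 hu
    obtain ⟨b, hb⟩ := hu'.exists_right_inv
    exact ⟨b, congrArg Subtype.val hb⟩
  obtain ⟨n, f, g, hfg⟩ := Submodule.mem_span_set'.1 hs
  choose x hx z hz hxz using fun i => (g i).2
  refine ⟨n, fun i => ⟨x i, hx i⟩,
    fun i => ⟨op (b : D) • (f i • z i), h.op_smul_mem _ _ b.2 (X.smul_mem _ (hz i))⟩, ?_⟩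
  simp only [E.rightInner_smul_right, E.rightInner_smul_complex, hxz, ← Finset.sum_mul]
  rw [hfg, hb]

theorem IsMoritaPair.ext_left (_h : IsMoritaPair A B E X) {w w' : X}
    (hw : ∀ x : X, E.leftInner w x = E.leftInner w' x) : w = w' := by
  rw [← sub_eq_zero]
  apply Subtype.ext
  apply E.leftInner_self_eq_zero
  have h2 := hw (w - w')
  have h3 : E.leftInner (w - w' : X) (w - w' : X)
      = E.leftInner w (w - w' : X) - E.leftInner w' (w - w' : X) :=
    map_sub (E.leftInnerₗ ((w - w' : X) : Y)) (w : Y) (w' : Y)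
  rw [h3, h2, sub_self]

theorem IsMoritaPair.ext_right (h : IsMoritaPair A B E X) {d d' : D}
    (hd : ∀ x : X, op d • (x : Y) = op d' • (x : Y)) : d = d' := by
  obtain ⟨n, x, z, hxz⟩ := h.exists_frame
  rw [← one_mul d, ← one_mul d', ← hxz, Finset.sum_mul, Finset.sum_mul]
  refine Finset.sum_congr rfl fun i _ => ?_
  rw [← E.rightInner_smul_right, ← E.rightInner_smul_right, hd]

/-- For every bounded `A`-bimodule map `φ : C → A` there is exactly one pair `(τ, ψ)` that satisfies
the conditions of `IsTransfer`. -/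
theorem IsMoritaPair.existsUnique_transfer (h : IsMoritaPair A B E X) (φ : BimoduleMaps A) :
    ∃! p : (Y →ₗ[ℂ] X) × BimoduleMaps B, IsTransfer E φ p.1 p.2 := by
  obtain ⟨n, x, z, hxz⟩ := h.exists_frame
  have hexp : ∀ y : Y, ∑ i, E.leftInner y (x i) • (z i : Y) = y := by
    intro y
    simp only [E.leftInner_smul]
    rw [← Finset.sum_smul, ← Finset.op_sum, hxz, op_one, one_smul]
  have hφl : ∀ (a c : C), a ∈ A → (φ.1 (a * c) : C) = a * φ.1 c := fun a c ha =>
    congrArg Subtype.val (φ.2 ⟨a, ha⟩ c).1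
  have hφr : ∀ (a c : C), a ∈ A → (φ.1 (c * a) : C) = φ.1 c * a := fun a c ha =>
    congrArg Subtype.val (φ.2 ⟨a, ha⟩ c).2
  let τ : Y →ₗ[ℂ] X :=
    { toFun := fun y => ∑ i, ⟨(φ.1 (E.leftInner y (x i)) : C) • (z i : Y),
        h.smul_mem _ _ (φ.1 _).2 (z i).2⟩
      map_add' := fun y y' => by
        rw [← Finset.sum_add_distrib]
        refine Finset.sum_congr rfl fun i _ => Subtype.ext ?_
        simp [E.leftInner_add_left, add_smul]
      map_smul' := fun t y => by
        rw [RingHom.id_apply, Finset.smul_sum]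
        refine Finset.sum_congr rfl fun i _ => Subtype.ext ?_
        simp [E.leftInner_smul_complex, E.smul_assoc_left] }
  have hτ : ∀ y, (τ y : Y) = ∑ i, (φ.1 (E.leftInner y (x i)) : C) • (z i : Y) := by
    intro y
    simp [τ]
  have h3 : ∀ (y : Y) (w : X), E.leftInner (τ y) w = φ.1 (E.leftInner y w) := by
    intro y w
    rw [hτ, E.leftInner_sum]
    conv_rhs => rw [← hexp y, E.leftInner_sum, map_sum, AddSubmonoidClass.coe_finsetSum]
    refine Finset.sum_congr rfl fun i _ => ?_
    rw [E.leftInner_smul_left, E.leftInner_smul_left,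
      hφr _ _ (h.leftInner_mem _ _ (z i).2 w.2)]
  have h1 : ∀ (c : C) (w : X), (τ (c • (w : Y)) : Y) = (φ.1 c : C) • (w : Y) := by
    intro c w
    refine congrArg Subtype.val (h.ext_left (w := τ (c • (w : Y)))
      (w' := ⟨_, h.smul_mem _ _ (φ.1 c).2 w.2⟩) fun v => ?_)
    rw [h3, E.leftInner_smul_left, E.leftInner_smul_left,
      hφr _ _ (h.leftInner_mem _ _ w.2 v.2)]
  have h2 : ∀ (a : A) (y : Y), (τ ((a : C) • y) : Y) = (a : C) • (τ y : Y) := by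
    intro a y
    refine congrArg Subtype.val (h.ext_left (w := τ ((a : C) • y))
      (w' := ⟨_, h.smul_mem _ _ a.2 (τ y).2⟩) fun v => ?_)
    rw [h3, E.leftInner_smul_left, E.leftInner_smul_left, h3, hφl _ _ a.2]
  have h5 : ∀ (b : B) (y : Y), (τ (op (b : D) • y) : Y) = op (b : D) • (τ y : Y) := by
    intro b y
    refine congrArg Subtype.val (h.ext_left (w := τ (op (b : D) • y))
      (w' := ⟨_, h.op_smul_mem _ _ b.2 (τ y).2⟩) fun v => ?_)
    have := h3 y ⟨_, h.op_smul_mem _ _ (star_mem b.2) v.2⟩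
    rw [h3, E.leftInner_op_smul, E.leftInner_op_smul, this]
  let ψ₀ : D → D := fun d => ∑ i, E.rightInner (x i) (τ (op d • (z i : Y)))
  have hψ₀ : ∀ d, ψ₀ d ∈ B := fun d =>
    sum_mem fun i _ => h.rightInner_mem _ _ (x i).2 (τ _).2
  have h4 : ∀ (d : D) (w : X), (τ (op d • (w : Y)) : Y) = op (ψ₀ d) • (w : Y) := by
    intro d w
    simp only [ψ₀, Finset.op_sum, Finset.sum_smul, ← E.leftInner_smul]
    conv_lhs => rw [← hexp w, Finset.smul_sum, map_sum, AddSubmonoidClass.coe_finsetSum]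
    refine Finset.sum_congr rfl fun i _ => ?_
    rw [← E.smul_comm]
    exact h2 ⟨_, h.leftInner_mem _ _ w.2 (x i).2⟩ _
  let ψ₁ : D →ₗ[ℂ] B :=
    { toFun := fun d => ⟨ψ₀ d, hψ₀ d⟩
      map_add' := fun d d' => Subtype.ext (h.ext_right fun w => by
        change _ = op (ψ₀ d + ψ₀ d') • (w : Y)
        rw [← h4, op_add, op_add, add_smul, add_smul, ← h4, ← h4, map_add, X.coe_add])
      map_smul' := fun t d => Subtype.ext (h.ext_right fun w => by
        change _ = op (t • ψ₀ d) • (w : Y)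
        rw [← h4, E.smul_assoc_right, E.smul_assoc_right, ← h4, map_smul, X.coe_smul]) }
  have hcont : Continuous ψ₁ := by
    refine Continuous.subtype_mk (f := ψ₀) ?_ hψ₀
    refine continuous_finsetSum _ fun i _ => ?_
    refine (E.continuous_rightInner (x i)).comp ?_
    simp only [hτ]
    refine continuous_finsetSum _ fun j _ => ?_
    refine (E.smulₗ (z j : Y)).continuous.comp (continuous_subtype_val.comp
      (φ.1.continuous.comp ?_))
    exact (E.continuous_leftInner (x j)).comp (E.opSmulₗ (z i : Y)).continuous
  let ψ : BimoduleMaps B := ⟨⟨ψ₁, hcont⟩, fun b d => by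
    constructor
    · refine Subtype.ext (h.ext_right fun w => ?_)
      change op (ψ₀ (b * d)) • (w : Y) = op (b * ψ₀ d) • (w : Y)
      rw [← h4, op_mul, op_mul, mul_smul, mul_smul]
      exact h4 d ⟨_, h.op_smul_mem _ _ b.2 w.2⟩
    · refine Subtype.ext (h.ext_right fun w => ?_)
      change op (ψ₀ (d * b)) • (w : Y) = op (ψ₀ d * b) • (w : Y)
      rw [← h4, op_mul, op_mul, mul_smul, mul_smul, h5, h4]⟩
  refine ⟨(τ, ψ), ⟨h1, h2, h3, h4, h5, fun w y => h.ext_right fun v => ?_⟩, ?_⟩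
  · change op (ψ₀ _) • (v : Y) = _
    rw [← h4, ← E.leftInner_smul, ← E.leftInner_smul]
    exact h2 ⟨_, h.leftInner_mem _ _ v.2 w.2⟩ y
  · rintro ⟨τ', ψ'⟩ h'
    have hττ : τ' = τ := LinearMap.ext fun y => h.ext_left fun w => by
      rw [h'.leftInner_tau, h3]
    refine Prod.ext hττ (Subtype.ext (ContinuousLinearMap.ext fun d => Subtype.ext
      (h.ext_right fun w => ?_)))
    have := h'.tau_op_smul d w
    change op (ψ'.1 d : D) • (w : Y) = op (ψ₀ d) • (w : Y)
    rw [← this, ← h4]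
    exact congrArg (fun σ : Y →ₗ[ℂ] X => (σ (op d • (w : Y)) : Y)) hττ

/-- The map `f` from bounded `A`-bimodule maps `C → A` to bounded `B`-bimodule maps `D → B` induced
by `Y` and `X`: `transfer h φ` is the unique `ψ` which, with the unique `τ`, satisfies the
conditions of `IsTransfer`. -/
noncomputable def transfer (h : IsMoritaPair A B E X) (φ : BimoduleMaps A) : BimoduleMaps B :=
  (h.existsUnique_transfer φ).choose.2

end Transfer

end InclusionMorita

/-!
Since `A` and `B` are unital and the inner products of `X` span them densely, there are finite
families in `X` with `∑ ⟨xⱼ, zⱼ⟩_D = 1` and `∑ ⟨wₗ, w'ₗ⟩_C = 1`. Hence `y = ∑ ⟨y, xⱼ⟩_C · zⱼ` and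
`y = ∑ wₗ · ⟨w'ₗ, y⟩_D` on all of `Y`.

*Positivity.* The identity `⟨x · ψ d, x⟩_C = φ ⟨x · d, x⟩_C` carries positivity from `φ` to the
quadratic forms `x ↦ ⟨x · ψ d, x⟩_C` on `X`, and an element of `B` with positive form is positive:
restricting the form to the range of the negative part shows that this part vanishes.

*Index.* If `(uᵢ, vᵢ)` is a quasi-basis for `φ`, then `y = ∑ uᵢ · τ (vᵢ · y)`, and expanding in the
two families shows that `⟨xⱼ, uᵢ · wₗ⟩_D` and `⟨w'ₗ, vᵢ · zⱼ⟩_D` satisfy the first quasi-basis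
identity for `ψ`. The second identity follows from the first as soon as `(d, d') ↦ ψ (d * d')` is
nondegenerate on the left, a property that `ψ` inherits from `φ`.
-/

namespace InclusionMorita

open MulOpposite

section CStarAlgebra

variable {C : Type*} [CStarAlgebra C] {A : StarSubalgebra ℂ C}

theorem exists_mem_mul_eq_one_of_one_mem_closure (hA : IsClosed (A : Set C)) {S : Set C}
    (hSA : S ⊆ A) (hS : (1 : C) ∈ closure S) : ∃ s ∈ S, ∃ a ∈ A, a * s = 1 := by
  obtain ⟨s, hs_unit, hs⟩ :=
    mem_closure_iff.1 hS {s | IsUnit s} Units.isOpen isUnit_one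
  obtain ⟨a, ha⟩ := ((StarSubalgebra.coe_isUnit (a := ⟨s, hSA hs⟩)).1 hs_unit).exists_left_inv
  exact ⟨s, hs, a, a.2, congrArg Subtype.val ha⟩

theorem negPart_mem_of_isClosed (hA : IsClosed (A : Set C)) {a : C} (ha : a ∈ A) : a⁻ ∈ A := by
  rw [CFC.negPart_def]
  exact cfcₙ_mem (𝕜' := ℂ) _ ha

theorem negPart_mul_self {a : C} (ha : IsSelfAdjoint a) : a⁻ * a = -(a⁻ * a⁻) := by
  nth_rw 2 [← CFC.posPart_sub_negPart a ha]
  rw [mul_sub, CFC.negPart_mul_posPart, zero_sub]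

end CStarAlgebra

section BimoduleMaps

variable {C : Type*} [CStarAlgebra C] {A : StarSubalgebra ℂ C} {φ : BimoduleMaps A}

theorem BimoduleMaps.map_mul_left (φ : BimoduleMaps A) (a : A) (c : C) :
    (φ.1 (a * c) : C) = a * φ.1 c :=
  congrArg Subtype.val (φ.2 a c).1

theorem BimoduleMaps.map_mul_right (φ : BimoduleMaps A) (c : C) (a : A) :
    (φ.1 (c * a) : C) = φ.1 c * a :=
  congrArg Subtype.val (φ.2 a c).2

/-- The form `(c, c') ↦ φ (c * c')` is nondegenerate in its first variable; compare
`LinearMap.SeparatingLeft`. -/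
def IsSeparatingLeft (φ : BimoduleMaps A) : Prop :=
  ∀ e : C, (∀ c : C, φ.1 (e * c) = 0) → e = 0

theorem IsQuasiBasis.isSeparatingLeft {m : ℕ} {u v : Fin m → C} (huv : IsQuasiBasis φ u v) :
    IsSeparatingLeft φ := fun e he => by
  simpa [he] using (huv e).2

theorem IsSeparatingLeft.isIndexFinite (hφ : IsSeparatingLeft φ) {ι : Type*} [Fintype ι]
    {u v : ι → C} (huv : ∀ c : C, c = ∑ i, u i * (φ.1 (v i * c) : C)) : IsIndexFinite φ := by
  have huv' (c : C) : c = ∑ i, (φ.1 (c * u i) : C) * v i := by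
    refine sub_eq_zero.1 (hφ _ fun c' => Subtype.ext ?_)
    rw [sub_mul, map_sub, AddSubgroupClass.coe_sub, ZeroMemClass.coe_zero, sub_eq_zero]
    calc (φ.1 (c * c') : C)
        = ∑ i, (φ.1 (c * u i * (φ.1 (v i * c') : C)) : C) := by
          conv_lhs => rw [huv c']
          simp only [Finset.mul_sum, mul_assoc, map_sum, AddSubmonoidClass.coe_finsetSum]
      _ = ∑ i, (φ.1 ((φ.1 (c * u i) : C) * (v i * c')) : C) := by
          simp only [BimoduleMaps.map_mul_left, BimoduleMaps.map_mul_right]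
      _ = φ.1 ((∑ i, (φ.1 (c * u i) : C) * v i) * c') := by
          simp only [Finset.sum_mul, mul_assoc, map_sum, AddSubmonoidClass.coe_finsetSum]
  let e := (Fintype.equivFin ι).symm
  exact ⟨_, u ∘ e, v ∘ e, fun c =>
    ⟨(huv c).trans (e.sum_comp fun i => u i * (φ.1 (v i * c) : C)).symm,
      (huv' c).trans (e.sum_comp fun i => (φ.1 (c * u i) : C) * v i).symm⟩⟩

end BimoduleMaps

variable {C D Y : Type*}
  [CStarAlgebra C] [PartialOrder C] [StarOrderedRing C]
  [CStarAlgebra D] [PartialOrder D] [StarOrderedRing D]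
  [NormedAddCommGroup Y] [NormedSpace ℂ Y] [CompleteSpace Y]
  [Module C Y] [Module Dᵐᵒᵖ Y]

namespace EquivalenceBimodule

variable (E : EquivalenceBimodule C D Y)

theorem rightInner_sum {ι : Type*} (s : Finset ι) (x : Y) (y : ι → Y) :
    E.rightInner x (∑ i ∈ s, y i) = ∑ i ∈ s, E.rightInner x (y i) :=
  map_sum (E.rightInnerₗ x) y s

theorem leftInner_sum_right {ι : Type*} (s : Finset ι) (x : Y) (y : ι → Y) :
    E.leftInner x (∑ i ∈ s, y i) = ∑ i ∈ s, E.leftInner x (y i) := by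
  simp only [← E.star_leftInner _ x, E.leftInner_sum, star_sum]

theorem leftInner_smul_right (c : C) (x y : Y) :
    E.leftInner x (c • y) = E.leftInner x y * star c := by
  rw [← E.star_leftInner, E.leftInner_smul_left, star_mul, E.star_leftInner]

theorem leftInner_op_smul_right (d : D) (x y : Y) :
    E.leftInner x (op d • y) = E.leftInner (op (star d) • x) y := by
  rw [E.leftInner_op_smul, star_star]

theorem leftInner_op_star_mul_self_smul (d : D) (y : Y) :
    E.leftInner (op (star d * d) • y) y
      = E.leftInner (op (star d) • y) (op (star d) • y) := by
  rw [op_mul, mul_smul, E.leftInner_op_smul]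

theorem leftInner_op_smul_self_nonneg {d : D} (hd : 0 ≤ d) (y : Y) :
    0 ≤ E.leftInner (op d • y) y := by
  obtain ⟨e, rfl⟩ := CStarAlgebra.nonneg_iff_eq_star_mul_self.1 hd
  rw [E.leftInner_op_star_mul_self_smul]
  exact E.leftInner_self_nonneg _

theorem op_smul_eq_zero_of_leftInner_eq_zero {d : D} (hd : 0 ≤ d) {y : Y}
    (hy : E.leftInner (op d • y) y = 0) : op d • y = 0 := by
  obtain ⟨e, rfl⟩ := CStarAlgebra.nonneg_iff_eq_star_mul_self.1 hd
  rw [E.leftInner_op_star_mul_self_smul] at hy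
  rw [op_mul, mul_smul, E.leftInner_self_eq_zero _ hy, smul_zero]

theorem sum_leftInner_smul {ι : Type*} [Fintype ι] {x z : ι → Y}
    (hxz : ∑ i, E.rightInner (x i) (z i) = 1) (y : Y) :
    ∑ i, E.leftInner y (x i) • z i = y := by
  simp only [E.leftInner_smul]
  rw [← Finset.sum_smul, ← Finset.op_sum, hxz, op_one, one_smul]

theorem sum_op_rightInner_smul {ι : Type*} [Fintype ι] {x z : ι → Y}
    (hxz : ∑ i, E.leftInner (x i) (z i) = 1) (y : Y) :
    ∑ i, op (E.rightInner (z i) y) • x i = y := by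
  simp only [← E.leftInner_smul]
  rw [← Finset.sum_smul, hxz, one_smul]

end EquivalenceBimodule

variable {A : StarSubalgebra ℂ C} {B : StarSubalgebra ℂ D}
  {E : EquivalenceBimodule C D Y} {X : Submodule ℂ Y}

namespace IsMoritaPair

theorem exists_left_frame (h : IsMoritaPair A B E X) :
    ∃ (n : ℕ) (x z : Fin n → X), ∑ i, E.leftInner (x i) (z i) = 1 := by
  obtain ⟨s, hs, a, ha, has⟩ := exists_mem_mul_eq_one_of_one_mem_closure h.isClosed_left
    (subset_closure.trans h.closure_left.subset) (h.closure_left.superset A.one_mem)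
  obtain ⟨n, t, g, rfl⟩ := Submodule.mem_span_set'.1 hs
  choose x hx z hz hxz using fun i => (g i).2
  refine ⟨n, fun i => ⟨a • t i • x i, h.smul_mem _ _ ha (X.smul_mem _ (hx i))⟩,
    fun i => ⟨z i, hz i⟩, ?_⟩
  simpa only [E.leftInner_smul_left, E.leftInner_smul_complex, hxz, ← Finset.mul_sum] using has

theorem eq_zero_of_op_smul_eq_zero (h : IsMoritaPair A B E X) {d : D}
    (hd : ∀ x : X, op d • (x : Y) = 0) : d = 0 :=
  h.ext_right fun x => by rw [hd, op_zero, zero_smul]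

theorem eq_zero_of_leftInner_eq_zero (h : IsMoritaPair A B E X) {y : Y}
    (hy : ∀ x : X, E.leftInner y x = 0) : y = 0 := by
  obtain ⟨n, x, z, hxz⟩ := h.exists_frame
  rw [← E.sum_leftInner_smul hxz y]
  simp only [hy, zero_smul, Finset.sum_const_zero]

theorem nonneg_of_isSelfAdjoint_of_leftInner_nonneg (h : IsMoritaPair A B E X) {b : D}
    (hb : b ∈ B) (hsa : IsSelfAdjoint b) (hpos : ∀ x : X, 0 ≤ E.leftInner (op b • (x : Y)) x) :
    0 ≤ b := by
  have hneg : b⁻ ∈ B := negPart_mem_of_isClosed h.isClosed_right hb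
  have hneg_nonneg : 0 ≤ b⁻ := CFC.negPart_nonneg b
  have hsq : b⁻ * b⁻ = 0 := by
    refine h.eq_zero_of_op_smul_eq_zero fun x => ?_
    -- `b` acts as `-b⁻` on the range of `b⁻`.
    have hform : 0 ≤ -E.leftInner (op b⁻ • op b⁻ • (x : Y)) (op b⁻ • (x : Y)) := by
      have := hpos ⟨op b⁻ • (x : Y), h.op_smul_mem _ _ hneg x.2⟩
      rwa [← mul_smul, ← op_mul, negPart_mul_self hsa, op_neg, neg_smul, ← neg_one_smul ℂ,
        E.leftInner_smul_complex, neg_one_smul, op_mul, mul_smul] at this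
    rw [op_mul, mul_smul]
    exact E.op_smul_eq_zero_of_leftInner_eq_zero hneg_nonneg
      (le_antisymm (neg_nonneg.1 hform) (E.leftInner_op_smul_self_nonneg hneg_nonneg _))
  have hneg_zero : b⁻ = 0 := by
    rwa [← CStarRing.star_mul_self_eq_zero_iff, hneg_nonneg.isSelfAdjoint.star_eq]
  exact (CFC.negPart_eq_zero_iff b hsa).1 hneg_zero

theorem eq_zero_of_isSelfAdjoint_of_leftInner_eq_zero (h : IsMoritaPair A B E X) {b : D}
    (hb : b ∈ B) (hsa : IsSelfAdjoint b) (hzero : ∀ x : X, E.leftInner (op b • (x : Y)) x = 0) :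
    b = 0 := by
  refine le_antisymm (neg_nonneg.1 ?_) ?_
  · refine h.nonneg_of_isSelfAdjoint_of_leftInner_nonneg (neg_mem hb) hsa.neg fun x => ?_
    rw [op_neg, neg_smul, ← neg_one_smul ℂ, E.leftInner_smul_complex, hzero, smul_zero]
  · exact h.nonneg_of_isSelfAdjoint_of_leftInner_nonneg hb hsa fun x => (hzero x).ge

theorem isSelfAdjoint_of_leftInner_isSelfAdjoint (h : IsMoritaPair A B E X) {b : D} (hb : b ∈ B)
    (hsa : ∀ x : X, IsSelfAdjoint (E.leftInner (op b • (x : Y)) x)) : IsSelfAdjoint b := by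
  have hdiff : Complex.I • (b - star b) = 0 := by
    refine h.eq_zero_of_isSelfAdjoint_of_leftInner_eq_zero
      (B.smul_mem (sub_mem hb (star_mem hb)) _) ?_ fun x => ?_
    · rw [Complex.isSelfAdjoint_I_smul_iff_mem_skewAdjoint, skewAdjoint.mem_iff, star_sub,
        star_star, neg_sub]
    · have hstar : E.leftInner (op (star b) • (x : Y)) x = E.leftInner (op b • (x : Y)) x := by
        rw [E.leftInner_op_smul, star_star, ← E.star_leftInner, (hsa x).star_eq]
      rw [E.smul_assoc_right, E.leftInner_smul_complex, op_sub, sub_eq_add_neg, add_smul, neg_smul,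
        ← neg_one_smul ℂ, E.leftInner_add_left, E.leftInner_smul_complex, hstar, neg_one_smul,
        add_neg_cancel, smul_zero]
  exact (sub_eq_zero.1 ((smul_eq_zero_iff_right Complex.I_ne_zero).1 hdiff)).symm

theorem nonneg_of_leftInner_nonneg (h : IsMoritaPair A B E X) {b : D} (hb : b ∈ B)
    (hpos : ∀ x : X, 0 ≤ E.leftInner (op b • (x : Y)) x) : 0 ≤ b :=
  h.nonneg_of_isSelfAdjoint_of_leftInner_nonneg hb
    (h.isSelfAdjoint_of_leftInner_isSelfAdjoint hb fun x => (hpos x).isSelfAdjoint) hpos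

theorem exists_isTransfer (h : IsMoritaPair A B E X) (φ : BimoduleMaps A) :
    ∃ τ : Y →ₗ[ℂ] X, IsTransfer E φ τ (transfer h φ) :=
  ⟨_, (h.existsUnique_transfer φ).choose_spec.1⟩

end IsMoritaPair

namespace IsTransfer

variable {φ : BimoduleMaps A} {τ : Y →ₗ[ℂ] X} {ψ : BimoduleMaps B}

theorem map_leftInner_op_smul (ht : IsTransfer E φ τ ψ) (d : D) (x x' : X) :
    (φ.1 (E.leftInner (op d • (x : Y)) x') : C) = E.leftInner (op (ψ.1 d : D) • (x : Y)) x' := by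
  rw [← ht.tau_op_smul, ht.leftInner_tau]

theorem map_coe (ht : IsTransfer E φ τ ψ) (h : IsMoritaPair A B E X)
    (hφ : ∀ a : A, φ.1 (a : C) = a) (b : B) : ψ.1 (b : D) = b := by
  refine Subtype.ext (h.ext_right fun x => ?_)
  have hτx : (τ x : Y) = x := by
    have hφ_one : (φ.1 1 : C) = 1 := congrArg Subtype.val (hφ 1)
    rw [← one_smul C (x : Y), ht.tau_smul, hφ_one]
  rw [← ht.tau_op_smul, ht.tau_op_smul_right, hτx]

theorem map_nonneg (ht : IsTransfer E φ τ ψ) (h : IsMoritaPair A B E X)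
    (hφ : ∀ c : C, 0 ≤ c → 0 ≤ (φ.1 c : C)) {d : D} (hd : 0 ≤ d) : 0 ≤ (ψ.1 d : D) :=
  h.nonneg_of_leftInner_nonneg (ψ.1 d).2 fun x => by
    rw [← ht.map_leftInner_op_smul]
    exact hφ _ (E.leftInner_op_smul_self_nonneg hd _)

theorem isConditionalExpectation (ht : IsTransfer E φ τ ψ) (h : IsMoritaPair A B E X)
    (hφ : IsConditionalExpectation φ) : IsConditionalExpectation ψ :=
  ⟨ht.map_coe h hφ.1, fun _ => ht.map_nonneg h hφ.2⟩

theorem isSeparatingLeft (ht : IsTransfer E φ τ ψ) (h : IsMoritaPair A B E X)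
    (hφ : IsSeparatingLeft φ) : IsSeparatingLeft ψ := by
  intro e he
  obtain ⟨n, w, w', hw⟩ := h.exists_left_frame
  have hφ_zero (x : X) (y : Y) : φ.1 (E.leftInner (op e • (x : Y)) y) = 0 := by
    rw [← E.sum_op_rightInner_smul hw y, E.leftInner_sum_right, map_sum]
    refine Finset.sum_eq_zero fun l _ => Subtype.ext ?_
    rw [E.leftInner_op_smul_right, ← mul_smul, ← op_mul, ht.map_leftInner_op_smul, he,
      ZeroMemClass.coe_zero, op_zero, zero_smul]
    exact map_zero (E.leftInnerₗ (w l : Y))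
  refine h.eq_zero_of_op_smul_eq_zero fun x => h.eq_zero_of_leftInner_eq_zero fun x' => ?_
  refine hφ _ fun c => ?_
  rw [← star_star c, ← E.leftInner_smul_right, hφ_zero]

theorem sum_smul_tau_smul (ht : IsTransfer E φ τ ψ) (h : IsMoritaPair A B E X)
    {ι : Type*} [Fintype ι] {u v : ι → C}
    (huv : ∀ c : C, c = ∑ i, u i * (φ.1 (v i * c) : C)) (y : Y) :
    ∑ i, u i • (τ (v i • y) : Y) = y := by
  obtain ⟨n, x, z, hxz⟩ := h.exists_frame
  have hsmul (c : C) (x : X) : ∑ i, u i • (τ (v i • c • (x : Y)) : Y) = c • (x : Y) := by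
    simp only [← mul_smul, ht.tau_smul, ← Finset.sum_smul, ← huv]
  rw [← E.sum_leftInner_smul hxz y]
  simp only [Finset.smul_sum, map_sum, AddSubmonoidClass.coe_finsetSum]
  rw [Finset.sum_comm]
  exact Finset.sum_congr rfl fun j _ => hsmul _ _

theorem tau_eq_sum (ht : IsTransfer E φ τ ψ) {κ : Type*} [Fintype κ] {w w' : κ → X}
    (hw : ∑ l, E.leftInner (w l) (w' l) = 1) (y : Y) :
    (τ y : Y) = ∑ l, op (ψ.1 (E.rightInner (w' l) y) : D) • (w l : Y) := by
  simp only [ht.psi_rightInner]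
  exact (E.sum_op_rightInner_smul hw _).symm

theorem eq_sum_rightInner_mul (ht : IsTransfer E φ τ ψ) (h : IsMoritaPair A B E X)
    {ι κ μ : Type*} [Fintype ι] [Fintype κ] [Fintype μ] {u v : ι → C}
    (huv : ∀ c : C, c = ∑ i, u i * (φ.1 (v i * c) : C)) {x z : κ → Y}
    (hxz : ∑ j, E.rightInner (x j) (z j) = 1) {w w' : μ → X}
    (hw : ∑ l, E.leftInner (w l) (w' l) = 1) (d : D) :
    d = ∑ j, ∑ i, ∑ l, E.rightInner (x j) (u i • (w l : Y)) *
      (ψ.1 (E.rightInner (w' l) (v i • z j) * d) : D) := by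
  calc d = ∑ j, E.rightInner (x j) (op d • z j) := by
        simp only [E.rightInner_smul_right, ← Finset.sum_mul, hxz, one_mul]
    _ = ∑ j, ∑ i, E.rightInner (x j) (u i • (τ (v i • op d • z j) : Y)) := by
        simp only [← E.rightInner_sum, ht.sum_smul_tau_smul h huv]
    _ = _ := by
        simp only [ht.tau_eq_sum hw, Finset.smul_sum, E.smul_comm, E.rightInner_sum,
          E.rightInner_smul_right]

theorem isIndexFinite (ht : IsTransfer E φ τ ψ) (h : IsMoritaPair A B E X)
    (hφ : IsIndexFinite φ) : IsIndexFinite ψ := by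
  obtain ⟨m, u, v, huv⟩ := hφ
  obtain ⟨n, x, z, hxz⟩ := h.exists_frame
  obtain ⟨k, w, w', hw⟩ := h.exists_left_frame
  let U (p : Fin n × Fin m × Fin k) : D := E.rightInner (x p.1) (u p.2.1 • (w p.2.2 : Y))
  let V (p : Fin n × Fin m × Fin k) : D := E.rightInner (w' p.2.2) (v p.2.1 • (z p.1 : Y))
  refine (ht.isSeparatingLeft h huv.isSeparatingLeft).isIndexFinite (u := U) (v := V) fun d => ?_
  simp only [Fintype.sum_prod_type]
  exact ht.eq_sum_rightInner_mul h (fun c => (huv c).1) hxz hw d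

end IsTransfer

end InclusionMorita

theorem corollary3p9 {C D Y : Type*}
    [CStarAlgebra C] [PartialOrder C] [StarOrderedRing C]
    [CStarAlgebra D] [PartialOrder D] [StarOrderedRing D]
    [NormedAddCommGroup Y] [NormedSpace ℂ Y] [CompleteSpace Y]
    [Module C Y] [Module Dᵐᵒᵖ Y]
    (A : StarSubalgebra ℂ C) (B : StarSubalgebra ℂ D)
    (E : InclusionMorita.EquivalenceBimodule C D Y) (X : Submodule ℂ Y)
    (h : InclusionMorita.IsMoritaPair A B E X)
    (φ : InclusionMorita.BimoduleMaps A)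
    (hφ : InclusionMorita.IsConditionalExpectation φ) (hφ' : InclusionMorita.IsIndexFinite φ) :
    InclusionMorita.IsConditionalExpectation (InclusionMorita.transfer h φ) ∧
      InclusionMorita.IsIndexFinite (InclusionMorita.transfer h φ) := by
  obtain ⟨τ, hτ⟩ := h.exists_isTransfer φ
  exact ⟨hτ.isConditionalExpectation h hφ, hτ.isIndexFinite h hφ'⟩
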